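/- Let $1\le M\le N$ and $1\le n<k\le K$ be integers. A base station with $M$ antennas serves a cluster $i\in\{1,\dots,M\}$ of $K$ users with $N$ antennas each, using the identity as precoding matrix. The $N\times M$ channel matrices $\mathbf H_1,\dots,\mathbf H_K$ of these users are independent with independent $\mathcal{CN}(0,1)$ entries. Let $\mathbf h_{i,j}$ be the $i$-th column of $\mathbf H_j$, let the columns of $\mathbf U_j$ be an orthonormal basis of the space of all vectors orthogonal to the other columns of $\mathbf H_j$, and let user $j$ use the detection vector $\mathbf v_j=\mathbf U_j\mathbf U_j^H\mathbf h_{i,j}/|\mathbf U_j^H\mathbf h_{i,j}|$. Let $x_1\ge\cdots\ge x_K$ be the effective channel gains $|\mathbf v_j^H\mathbf h_{i,j}|^2$, $j=1,\dots,K$, in decreasing order. The $n$-th and the $k$-th ordered users are paired for NOMA at transmit signal-to-noise ratio $\rho>0$, with the dynamic power allocation $$\alpha_n=\sqrt{\frac{\sqrt{1+\rho x_k}-1}{\rho x_k}},\qquad \alpha_k^2=1-\alpha_n^2 .$$ Let $R_n,R_k$ be fixed real target rates, and say that the $n$-th user is in outage if it cannot decode the message of the $k$-th user, i.e. $\log_2\!\big(1+\frac{x_n\alpha_k^2}{x_n\alpha_n^2+1/\rho}\big)\le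 R_k$, or can decode it but cannot decode its own message after removing it, i.e. $\log_2(1+\rho x_n\alpha_n^2)\le R_n$. Let $\mathrm P^o_n(\rho)$ be the probability of this event. Then $0\le\alpha_n\le 1$, and the NOMA rate of the $k$-th user is at least its OMA rate: $$\log_2\Big(1+\frac{x_k\alpha_k^2}{x_k\alpha_n^2+1/\rho}\Big)\ \ge\ \tfrac12\log_2(1+\rho x_k).$$ Moreover $\mathrm P^o_n(\rho)\ \dot\le\ \rho^{-(N-M+1)(K-k+1)}$, that is, $$\limsup_{\rho\to\infty}\frac{\log \mathrm P^o_n(\rho)}{\log\rho}\ \le\ -(N-M+1)(K-k+1).$$ Hence the diversity order $(N-M+1)(K-k+1)$ is achievable by the $n$-th user, that is, $$\liminf_{\rho\to\infty}\frac{-\log \mathrm P^o_n(\rho)}{\log\rho}\ \ge\ (N-M+1)(K-k+1).$$ -/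

import Mathlib

open MeasureTheory ProbabilityTheory Filter
open scoped ENNReal NNReal

/-! ### Rayleigh fading -/

/-- The standard circularly symmetric complex Gaussian law `CN(0,1)`: independent real and
imaginary parts, each real Gaussian with mean `0` and variance `1/2`. -/
noncomputable def stdComplexGaussian : Measure ℂ :=
  ((gaussianReal 0 (1 / 2)).prod (gaussianReal 0 (1 / 2))).map
    (fun p : ℝ × ℝ => (⟨p.1, p.2⟩ : ℂ))

/-- The `N × M` channel matrices `H j` of the `K` users `j` of one cluster are Rayleigh fading:
all their entries are independent and `CN(0,1)`. -/
structure IsRayleigh {Ω : Type*} [MeasurableSpace Ω] (μ : Measure Ω) {K N M : ℕ}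
    (H : Fin K → Ω → Matrix (Fin N) (Fin M) ℂ) : Prop where
  law : ∀ j a b, HasLaw (fun ω => H j ω a b) stdComplexGaussian μ
  indep : iIndepFun (fun (e : Fin K × Fin N × Fin M) (ω : Ω) => H e.1 ω e.2.1 e.2.2) μ

/-! ### Detection vectors and effective channel gains -/

section Detection

variable {N M : ℕ} (H : Matrix (Fin N) (Fin M) ℂ) (i : Fin M)

/-- The `m`-th column of the channel matrix, a vector of `ℂ^N`.  As the precoding matrix is the
identity, this is the channel seen by the signal of the `m`-th cluster. -/
noncomputable def chanCol (m : Fin M) : EuclideanSpace ℂ (Fin N) :=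
  WithLp.toLp 2 (fun a => H a m)

/-- The vectors `u` with `uᴴ h_m = 0` for all `m ≠ i`: the left null space of the channel matrix
with its `i`-th column removed. -/
noncomputable def leftNull : Submodule ℂ (EuclideanSpace ℂ (Fin N)) :=
  (Submodule.span ℂ {h | ∃ m, m ≠ i ∧ h = chanCol H m})ᗮ

/-- The columns of `U`: an orthonormal basis of the left null space (left singular vectors for
the singular value zero).  There are `N - M + 1` of them when the other columns are linearly
independent.  The effective gain below does not depend on the choice of the basis. -/
noncomputable def nullBasis :
    OrthonormalBasis (Fin (Module.finrank ℂ (leftNull H i))) ℂ (leftNull H i) :=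
  stdOrthonormalBasis ℂ (leftNull H i)

/-- The vector `Uᴴ h_i`. -/
noncomputable def projCoord : EuclideanSpace ℂ (Fin (Module.finrank ℂ (leftNull H i))) :=
  WithLp.toLp 2 (fun a => inner ℂ (nullBasis H i a : EuclideanSpace ℂ (Fin N)) (chanCol H i))

/-- The maximal ratio combining vector `z = Uᴴ h_i / |Uᴴ h_i|`. -/
noncomputable def mrcVector : EuclideanSpace ℂ (Fin (Module.finrank ℂ (leftNull H i))) :=
  ((‖projCoord H i‖⁻¹ : ℝ) : ℂ) • projCoord H i

/-- The detection vector `v = U z` of a user of the `i`-th cluster with channel matrix `H`. -/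
noncomputable def detVector : EuclideanSpace ℂ (Fin N) :=
  ∑ a, mrcVector H i a • (nullBasis H i a : EuclideanSpace ℂ (Fin N))

/-- The effective channel gain `|vᴴ h_i|²`. -/
noncomputable def effGain : ℝ := ‖inner ℂ (detVector H i) (chanCol H i)‖ ^ 2

/-- The detection vector removes all inter-cluster interference. -/
theorem inner_detVector_chanCol {m : Fin M} (hm : m ≠ i) :
    inner ℂ (detVector H i) (chanCol H m) = 0 := by
  have hmem : detVector H i ∈ leftNull H i :=
    Submodule.sum_mem _ fun a _ => Submodule.smul_mem _ _ (nullBasis H i a).2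
  exact (Submodule.mem_orthogonal' _ _).1 hmem _ (Submodule.subset_span ⟨m, hm, rfl⟩)

/-- The detection vector is normalized, unless `Uᴴ h_i = 0`. -/
theorem norm_detVector (h : projCoord H i ≠ 0) : ‖detVector H i‖ = 1 := by
  have h1 : detVector H i = ((nullBasis H i).repr.symm (mrcVector H i) : leftNull H i) := by
    rw [← OrthonormalBasis.sum_repr_symm]
    simp [detVector]
  rw [h1, ← Submodule.coe_norm, LinearIsometryEquiv.norm_map, mrcVector, norm_smul]
  have : ‖projCoord H i‖ ≠ 0 := norm_ne_zero_iff.2 h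
  simp [this]

end Detection

/-- The decreasing rearrangement `x_1 ≥ x_2 ≥ ⋯ ≥ x_K` of the values `x j`; the index `k` counts
from zero, so that `k = 0` is the largest value. -/
noncomputable def orderedDesc {K : ℕ} (x : Fin K → ℝ) (k : Fin K) : ℝ :=
  x (Tuple.sort (fun j => -x j) k)

theorem orderedDesc_antitone {K : ℕ} (x : Fin K → ℝ) : Antitone (orderedDesc x) := by
  intro a b hab
  have := Tuple.monotone_sort (fun j => -x j) hab
  simpa [orderedDesc] using this

/-- The effective channel gain of the `r`-th ordered user of the `i`-th cluster,
`1 ≤ r ≤ K` (the first user has the largest gain). -/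
noncomputable def userGain {Ω : Type*} {K N M : ℕ} (H : Fin K → Ω → Matrix (Fin N) (Fin M) ℂ)
    (i : Fin M) (r : ℕ) (hr : 1 ≤ r ∧ r ≤ K) (ω : Ω) : ℝ :=
  orderedDesc (fun j => effGain (H j ω) i) ⟨r - 1, by omega⟩

/-! ### Power allocation, rates and outage for two paired users

`xk` and `xn` are the effective gains of the weaker and the stronger user, `ρ` is the transmit
signal to noise ratio. -/

/-- The amplitude coefficient `α_n` of the stronger user for the dynamic QoS constraint. -/
noncomputable def alphaN (ρ xk : ℝ) : ℝ :=
  Real.sqrt ((Real.sqrt (1 + ρ * xk) - 1) / (ρ * xk))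

/-- The amplitude coefficient of the weaker user, `α_n² + α_k² = 1`. -/
noncomputable def alphaK (ρ xk : ℝ) : ℝ := Real.sqrt (1 - alphaN ρ xk ^ 2)

/-- SINR with which the message of the weaker user is decoded at a user with gain `x`. -/
noncomputable def sinrWeakMsg (ρ xk x : ℝ) : ℝ :=
  x * alphaK ρ xk ^ 2 / (x * alphaN ρ xk ^ 2 + 1 / ρ)

/-- SINR with which the stronger user decodes its own message, once the message of the weaker
user has been removed. -/
noncomputable def sinrOwn (ρ xk xn : ℝ) : ℝ := ρ * xn * alphaN ρ xk ^ 2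

/-- Rate of the weaker user with NOMA (bits per channel use). -/
noncomputable def nomaRateWeak (ρ xk : ℝ) : ℝ := Real.logb 2 (1 + sinrWeakMsg ρ xk xk)

/-- Rate of the weaker user with OMA, where each of the two users gets half of the resource. -/
noncomputable def omaRateWeak (ρ xk : ℝ) : ℝ := 1 / 2 * Real.logb 2 (1 + ρ * xk)

/-- Outage of the stronger user: it cannot decode the message of the weaker user (of rate `Rk`),
or it can, but then cannot decode its own message (of rate `Rn`). -/
def StrongOutage (Rk Rn ρ xk xn : ℝ) : Prop :=
  ¬ (Rk < Real.logb 2 (1 + sinrWeakMsg ρ xk xn)) ∨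
    (Rk < Real.logb 2 (1 + sinrWeakMsg ρ xk xn) ∧ ¬ (Rn < Real.logb 2 (1 + sinrOwn ρ xk xn)))

/-- Outage probability of the `n`-th ordered user of the `i`-th cluster, as a function of `ρ`,
when it is paired with the `k`-th ordered user, `n < k`. -/
noncomputable def outageProb {Ω : Type*} [MeasurableSpace Ω] (μ : Measure Ω) {K N M : ℕ}
    (H : Fin K → Ω → Matrix (Fin N) (Fin M) ℂ) (i : Fin M) (n k : ℕ)
    (hn : 1 ≤ n ∧ n ≤ K) (hk : 1 ≤ k ∧ k ≤ K) (Rn Rk : ℝ) (ρ : ℝ) : ℝ≥0∞ :=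
  μ {ω | StrongOutage Rk Rn ρ (userGain H i k hk ω) (userGain H i n hn ω)}

/-! ### Exponential order at high SNR -/

/-- `f ≤̇ g`: `lim log f(ρ) / log ρ ≤ lim log g(ρ) / log ρ` as `ρ → ∞`, with the upper limit on
the left and the lower limit on the right, so that no existence of limits is presupposed.
The logarithms are extended real valued, `log 0 = -∞`. -/
noncomputable def ExpLE (f g : ℝ → ℝ≥0∞) : Prop :=
  limsup (fun ρ : ℝ => ENNReal.log (f ρ) / (Real.log ρ : EReal)) atTop ≤
    liminf (fun ρ : ℝ => ENNReal.log (g ρ) / (Real.log ρ : EReal)) atTop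

/-- The error probability `P(ρ)` achieves diversity order `d`:
`liminf -log P(ρ) / log ρ ≥ d` as `ρ → ∞`. -/
noncomputable def AchievesDiversity (P : ℝ → ℝ≥0∞) (d : ℝ) : Prop :=
  (d : EReal) ≤ liminf (fun ρ : ℝ => -ENNReal.log (P ρ) / (Real.log ρ : EReal)) atTop

/-! ### Rates of the paired users -/

/-! Put s = √(1 + ρ x_k). The allocation is tuned so that α_n² = 1/(s + 1), and then every user with
gain at least x_k has 1 + SINR ≥ s for both messages. For the weaker user this is the rate
comparison; for the stronger one, outage forces s ≤ 2^max(R_k, R_n), hence x_k < ε with ε = O(1/ρ)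
(`StrongOutage.gain_lt`).

Then the K - k + 1 weakest users all have gain below ε. A gain is the squared distance of the i-th
column to the span of the other M - 1 columns. With those frozen, a gain below ε confines at least
2(N - M + 1) independent real Gaussian coordinates to (-√ε, √ε), each with probability at most 2√ε,
so one user contributes (4ε)^(N-M+1) (`pi_nearSpan_le`). Independence of the users and a union bound
over the sets of weak users give P ≤ C ρ^(-D) with D = (N-M+1)(K-k+1) (`IsRayleigh.outageProb_le`);
the constant C disappears after division by log ρ. -/

theorem alphaN_sq {ρ x : ℝ} (h : 0 < ρ * x) :
    alphaN ρ x ^ 2 = 1 / (Real.sqrt (1 + ρ * x) + 1) := by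
  have hs : Real.sqrt (1 + ρ * x) ^ 2 = 1 + ρ * x := Real.sq_sqrt (by linarith)
  have h1 : 1 ≤ Real.sqrt (1 + ρ * x) := Real.one_le_sqrt.2 (by linarith)
  rw [alphaN, Real.sq_sqrt (div_nonneg (by linarith) h.le), div_eq_div_iff h.ne' (by linarith)]
  linarith

theorem alphaN_mem_Icc {ρ x : ℝ} (h : 0 ≤ ρ * x) : alphaN ρ x ∈ Set.Icc (0 : ℝ) 1 := by
  have h0 : 0 ≤ alphaN ρ x := Real.sqrt_nonneg _
  refine ⟨h0, ?_⟩
  rcases h.eq_or_lt with h | h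
  · simp [alphaN, ← h]
  · rw [← sq_le_one_iff₀ h0, alphaN_sq h]
    exact div_le_one_of_le₀ (by linarith [Real.sqrt_nonneg (1 + ρ * x)]) (by positivity)

theorem alphaK_sq {ρ x : ℝ} (h : 0 ≤ ρ * x) : alphaK ρ x ^ 2 = 1 - alphaN ρ x ^ 2 := by
  obtain ⟨h0, h1⟩ := alphaN_mem_Icc h
  exact Real.sq_sqrt (by nlinarith)

/-- Any user which is at least as strong as the weaker user of the pair sees the message of the
weaker user with an SINR of at least `√(1 + ρ x_k) - 1`. -/
theorem sqrt_le_one_add_sinrWeakMsg {ρ xk x : ℝ} (hρ : 0 < ρ) (hxk : 0 ≤ xk) (hx : xk ≤ x) :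
    Real.sqrt (1 + ρ * xk) ≤ 1 + sinrWeakMsg ρ xk x := by
  -- At gain zero the quotient in `alphaN` is 0 / 0 = 0, so all power goes to the weaker user and
  -- the bound reads 1 ≤ 1 + SINR.
  rcases hxk.eq_or_lt with h | h
  · subst h
    have : 0 ≤ sinrWeakMsg ρ 0 x := by unfold sinrWeakMsg; positivity
    simpa using this
  · have hp : 0 < ρ * xk := by positivity
    have hs : Real.sqrt (1 + ρ * xk) ^ 2 = 1 + ρ * xk := Real.sq_sqrt (by linarith)
    have h1 : 1 ≤ Real.sqrt (1 + ρ * xk) := Real.one_le_sqrt.2 (by linarith)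
    rw [sinrWeakMsg, alphaK_sq hp.le, alphaN_sq hp]
    set s := Real.sqrt (1 + ρ * xk)
    have hx0 : 0 < x := h.trans_le hx
    have hu : ρ * xk ≤ ρ * x := by gcongr
    have e : x * (1 - 1 / (s + 1)) / (x * (1 / (s + 1)) + 1 / ρ) = ρ * x * s / (ρ * x + s + 1) := by
      have : s + 1 ≠ 0 := by positivity
      have : ρ * x + s + 1 ≠ 0 := by positivity
      have : x * (1 / (s + 1)) + 1 / ρ ≠ 0 := by positivity
      field_simp
      ring
    rw [e]
    have : s - 1 ≤ ρ * x * s / (ρ * x + s + 1) := by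
      rw [le_div_iff₀ (by positivity)]
      -- With u = ρx, (s - 1)(u + s + 1) = us - u + (s² - 1), and s² - 1 = ρ x_k ≤ u.
      nlinarith
    linarith

theorem sqrt_le_one_add_sinrOwn {ρ xk x : ℝ} (hρ : 0 < ρ) (hxk : 0 ≤ xk) (hx : xk ≤ x) :
    Real.sqrt (1 + ρ * xk) ≤ 1 + sinrOwn ρ xk x := by
  rcases hxk.eq_or_lt with h | h
  · subst h
    simp [sinrOwn, alphaN]
  · have hp : 0 < ρ * xk := by positivity
    have hs : Real.sqrt (1 + ρ * xk) ^ 2 = 1 + ρ * xk := Real.sq_sqrt (by linarith)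
    have h1 : 1 ≤ Real.sqrt (1 + ρ * xk) := Real.one_le_sqrt.2 (by linarith)
    rw [sinrOwn, alphaN_sq hp]
    set s := Real.sqrt (1 + ρ * xk)
    have hu : ρ * xk ≤ ρ * x := by gcongr
    have : s - 1 ≤ ρ * x * (1 / (s + 1)) := by
      rw [mul_one_div, le_div_iff₀ (by positivity)]
      nlinarith
    linarith

theorem omaRateWeak_le_nomaRateWeak {ρ x : ℝ} (hρ : 0 < ρ) (hx : 0 ≤ x) :
    omaRateWeak ρ x ≤ nomaRateWeak ρ x := by
  have h : 0 < 1 + ρ * x := by positivity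
  have : omaRateWeak ρ x = Real.logb 2 (Real.sqrt (1 + ρ * x)) := by
    rw [omaRateWeak, Real.logb, Real.logb, Real.log_sqrt h.le]
    ring
  rw [this]
  exact Real.logb_le_logb_of_le one_lt_two (Real.sqrt_pos.2 h)
    (sqrt_le_one_add_sinrWeakMsg hρ hx le_rfl)

/-- If the stronger user is in outage, then the gain of the weaker user is `O(1 / ρ)`. -/
theorem StrongOutage.gain_lt {Rk Rn ρ xk x : ℝ} (hρ : 0 < ρ) (hxk : 0 ≤ xk) (hx : xk ≤ x)
    (h : StrongOutage Rk Rn ρ xk x) : xk < (2 ^ max Rk Rn) ^ 2 / ρ := by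
  have h0 : 0 < 1 + ρ * xk := by positivity
  have key : Real.sqrt (1 + ρ * xk) ≤ 2 ^ max Rk Rn := by
    have aux : ∀ {R y : ℝ}, R ≤ max Rk Rn → Real.sqrt (1 + ρ * xk) ≤ y →
        ¬ R < Real.logb 2 y → Real.sqrt (1 + ρ * xk) ≤ 2 ^ max Rk Rn := by
      intro R y hR hy hlog
      have hy0 : 0 < y := (Real.sqrt_pos.2 h0).trans_le hy
      exact hy.trans ((Real.logb_le_iff_le_rpow one_lt_two hy0).1 ((not_lt.1 hlog).trans hR))
    rcases h with h | ⟨-, h⟩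
    · exact aux (le_max_left _ _) (sqrt_le_one_add_sinrWeakMsg hρ hxk hx) h
    · exact aux (le_max_right _ _) (sqrt_le_one_add_sinrOwn hρ hxk hx) h
  rw [lt_div_iff₀ hρ]
  have := (Real.sqrt_le_left (by positivity)).1 key
  -- The 1 in 1 + ρ x_k makes the inequality strict.
  linarith

/-! ### Ordered gains -/

theorem exists_card_of_orderedDesc_lt {K : ℕ} {x : Fin K → ℝ} {k : Fin K} {ε : ℝ}
    (h : orderedDesc x k < ε) : ∃ S : Finset (Fin K), S.card = K - k ∧ ∀ j ∈ S, x j < ε := by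
  -- The users ranked k or later; ranks start at zero, so there are K - k of them.
  refine ⟨(Finset.Ici k).map (Tuple.sort fun j => -x j).toEmbedding, by simp, ?_⟩
  intro j hj
  obtain ⟨l, hl, rfl⟩ := Finset.mem_map.1 hj
  exact (orderedDesc_antitone x (Finset.mem_Ici.1 hl)).trans_lt h

/-! ### Exponential order -/

theorem tendsto_log_const_mul_rpow_div_log {C : ℝ} (hC : 0 < C) (D : ℝ) :
    Tendsto (fun ρ : ℝ => ENNReal.log (ENNReal.ofReal (C * ρ ^ (-D))) / (Real.log ρ : EReal))
      atTop (nhds ((-D : ℝ) : EReal)) := by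
  have h1 : Tendsto (fun ρ : ℝ => Real.log C / Real.log ρ - D) atTop (nhds (0 - D)) :=
    (Real.tendsto_log_atTop.const_div_atTop _).sub_const D
  rw [zero_sub] at h1
  refine ((continuous_coe_real_ereal.tendsto _).comp h1).congr' ?_
  filter_upwards [eventually_gt_atTop 1] with ρ hρ
  have hl : 0 < Real.log ρ := Real.log_pos hρ
  have hρ0 : 0 < ρ := by linarith
  rw [ENNReal.log_ofReal_of_pos (by positivity), ← EReal.coe_div, Function.comp_apply,
    Real.log_mul hC.ne' (by positivity), Real.log_rpow hρ0]
  congr 1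
  field_simp
  ring

theorem limsup_log_div_log_le {f : ℝ → ℝ≥0∞} {C D : ℝ} (hC : 0 < C)
    (h : ∀ᶠ ρ in atTop, f ρ ≤ ENNReal.ofReal (C * ρ ^ (-D))) :
    limsup (fun ρ : ℝ => ENNReal.log (f ρ) / (Real.log ρ : EReal)) atTop ≤ ((-D : ℝ) : EReal) := by
  rw [← (tendsto_log_const_mul_rpow_div_log hC D).limsup_eq]
  refine limsup_le_limsup ?_
  filter_upwards [h, eventually_gt_atTop 1] with ρ hf hρ
  exact EReal.div_le_div_right_of_nonneg (by exact_mod_cast (Real.log_pos hρ).le)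
    (ENNReal.log_monotone hf)

theorem expLE_rpow {f : ℝ → ℝ≥0∞} {C D : ℝ} (hC : 0 < C)
    (h : ∀ᶠ ρ in atTop, f ρ ≤ ENNReal.ofReal (C * ρ ^ (-D))) :
    ExpLE f fun ρ => ENNReal.ofReal (ρ ^ (-D)) := by
  have := (tendsto_log_const_mul_rpow_div_log one_pos D).liminf_eq
  simp only [one_mul] at this
  rw [ExpLE, this]
  exact limsup_log_div_log_le hC h

theorem achievesDiversity_of_le {f : ℝ → ℝ≥0∞} {C D : ℝ} (hC : 0 < C)
    (h : ∀ᶠ ρ in atTop, f ρ ≤ ENNReal.ofReal (C * ρ ^ (-D))) : AchievesDiversity f D := by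
  have e : (fun ρ : ℝ => -ENNReal.log (f ρ) / (Real.log ρ : EReal)) =
      -fun ρ : ℝ => ENNReal.log (f ρ) / (Real.log ρ : EReal) := by
    ext ρ
    simp [EReal.div_eq_inv_mul]
  rw [AchievesDiversity, e, EReal.liminf_neg, EReal.le_neg]
  simpa using limsup_log_div_log_le hC h

/-! ### Small ball estimates for complex Gaussian vectors -/

theorem measurable_complex_mk : Measurable fun p : ℝ × ℝ => (⟨p.1, p.2⟩ : ℂ) :=
  Complex.measurableEquivRealProd.symm.measurable

instance : IsProbabilityMeasure stdComplexGaussian :=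
  Measure.isProbabilityMeasure_map measurable_complex_mk.aemeasurable

/-- Both parts have variance 1/2, which gives the factor 1/4. That only ‖t‖ enters is the rotation
invariance used below. -/
theorem charFun_stdComplexGaussian (t : ℂ) :
    charFun stdComplexGaussian t = Complex.exp (-‖t‖ ^ 2 / 4) := by
  have h := charFun_prod (μ := gaussianReal 0 (1 / 2)) (ν := gaussianReal 0 (1 / 2))
    (WithLp.toLp 2 (t.re, t.im))
  rw [charFun_gaussianReal, charFun_gaussianReal, ← Complex.exp_add] at h
  rw [charFun_apply, integral_map (by fun_prop) (by fun_prop)] at h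
  rw [charFun_apply, stdComplexGaussian, integral_map measurable_complex_mk.aemeasurable
    (by fun_prop)]
  convert h using 2
  · ext p
    simp [Complex.inner, mul_comm]
  · have : ((‖t‖ : ℂ)) ^ 2 = (t.re : ℂ) ^ 2 + (t.im : ℂ) ^ 2 := by
      rw [← Complex.ofReal_pow, ← Complex.normSq_eq_norm_sq, Complex.normSq_apply]
      push_cast
      ring
    rw [this]
    simp
    ring

theorem charFun_pi_stdComplexGaussian {ι : Type*} [Fintype ι] (t : EuclideanSpace ℂ ι) :
    charFun ((Measure.pi fun _ : ι => stdComplexGaussian).map (WithLp.toLp 2)) t =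
      Complex.exp (-‖t‖ ^ 2 / 4) := by
  rw [charFun_pi]
  simp_rw [charFun_stdComplexGaussian, ← Complex.exp_sum]
  rw [← Complex.ofReal_pow, EuclideanSpace.norm_sq_eq]
  simp [Finset.sum_div, neg_div]

/-- The density is at most 1/√π ≤ 1, and the interval has length 2r. -/
theorem gaussianReal_Ioo_le (r : ℝ) :
    gaussianReal 0 (1 / 2) (Set.Ioo (-r) r) ≤ ENNReal.ofReal (2 * r) := by
  have hv : (1 / 2 : ℝ≥0) ≠ 0 := by norm_num
  have hpdf : ∀ x, gaussianPDF 0 (1 / 2) x ≤ 1 := by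
    intro x
    rw [gaussianPDF, ENNReal.ofReal_le_one, gaussianPDFReal]
    have h1 : 1 ≤ Real.sqrt (2 * Real.pi * ((1 / 2 : ℝ≥0) : ℝ)) := by
      rw [Real.one_le_sqrt]
      push_cast
      linarith [Real.pi_gt_three]
    refine mul_le_one₀ (inv_le_one_of_one_le₀ h1) (Real.exp_pos _).le (Real.exp_le_one_iff.2 ?_)
    rw [neg_div]
    have : 0 ≤ (x - 0) ^ 2 / (2 * ((1 / 2 : ℝ≥0) : ℝ)) := by positivity
    linarith
  rw [gaussianReal_of_var_ne_zero _ hv]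
  calc _ ≤ (volume.withDensity 1) (Set.Ioo (-r) r) :=
        withDensity_mono (Eventually.of_forall hpdf) _
    _ = _ := by
        rw [withDensity_one, Real.volume_Ioo]
        congr 1
        ring

/-- The coordinates of a complex Gaussian vector in a real orthonormal family are independent real
Gaussian variables. -/
theorem map_inner_pi_stdComplexGaussian {ι κ : Type*} [Fintype ι] [Fintype κ]
    {b : κ → EuclideanSpace ℂ ι} (hb : Orthonormal ℝ b) :
    ((Measure.pi fun _ : ι => stdComplexGaussian).map (WithLp.toLp 2)).map
      (fun h a => inner ℝ (b a) h) = Measure.pi fun _ : κ => gaussianReal 0 (1 / 2) := by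
  have hm : Measurable fun (h : EuclideanSpace ℂ ι) (a : κ) => inner ℝ (b a) h :=
    measurable_pi_lambda _ fun a => by fun_prop
  have := Measure.isProbabilityMeasure_map (μ := Measure.pi fun _ : ι => stdComplexGaussian)
    (f := WithLp.toLp 2) (by fun_prop)
  set γ := (Measure.pi fun _ : ι => stdComplexGaussian).map (WithLp.toLp 2) with hγ
  have := Measure.isProbabilityMeasure_map (μ := γ) hm.aemeasurable
  -- Characteristic functions need an inner product, so both laws are moved to `EuclideanSpace`.
  rw [← (MeasurableEquiv.toLp 2 (κ → ℝ)).map_measurableEquiv_injective.eq_iff]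
  have := Measure.isProbabilityMeasure_map (μ := γ.map (fun h a => inner ℝ (b a) h))
    (MeasurableEquiv.toLp 2 (κ → ℝ)).measurable.aemeasurable
  have := Measure.isProbabilityMeasure_map (μ := Measure.pi fun _ : κ => gaussianReal 0 (1 / 2))
    (MeasurableEquiv.toLp 2 (κ → ℝ)).measurable.aemeasurable
  apply Measure.ext_of_charFun (E := EuclideanSpace ℝ κ)
  ext t
  have h1 : charFun ((γ.map (fun h a => inner ℝ (b a) h)).map (MeasurableEquiv.toLp 2 (κ → ℝ))) t =
      charFun γ (∑ a, t a • b a) := by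
    rw [charFun_apply, integral_map (by fun_prop) (by fun_prop), charFun_apply,
      integral_map hm.aemeasurable (by fun_prop)]
    congr 1 with h
    congr 3
    rw [inner_sum, PiLp.inner_apply]
    simp [real_inner_smul_right, real_inner_comm]
  have h2 : ‖∑ a, t a • b a‖ ^ 2 = ∑ a, t a ^ 2 := by
    rw [← real_inner_self_eq_norm_sq, hb.inner_sum]
    simp [sq]
  rw [h1, hγ, charFun_pi_stdComplexGaussian, MeasurableEquiv.coe_toLp, charFun_pi,
    ← Complex.ofReal_pow, h2]
  simp_rw [charFun_gaussianReal, ← Complex.exp_sum]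
  congr 1
  push_cast
  rw [← Finset.sum_neg_distrib, Finset.sum_div]
  refine Finset.sum_congr rfl fun a _ => ?_
  ring

theorem pi_stdComplexGaussian_inner_lt_le {ι κ : Type*} [Fintype ι] [Fintype κ]
    {b : κ → EuclideanSpace ℂ ι} (hb : Orthonormal ℝ b) (r : ℝ) :
    (Measure.pi fun _ : ι => stdComplexGaussian)
      {y | ∀ a, |inner ℝ (b a) (WithLp.toLp 2 y : EuclideanSpace ℂ ι)| < r} ≤
      ENNReal.ofReal (2 * r) ^ Fintype.card κ := by
  have hm : Measurable fun (h : EuclideanSpace ℂ ι) (a : κ) => inner ℝ (b a) h :=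
    measurable_pi_lambda _ fun a => by fun_prop
  have hs : MeasurableSet (Set.univ.pi fun _ : κ => Set.Ioo (-r) r) :=
    MeasurableSet.univ_pi fun _ => measurableSet_Ioo
  have h := congrArg (fun m => m (Set.univ.pi fun _ : κ => Set.Ioo (-r) r))
    (map_inner_pi_stdComplexGaussian hb)
  rw [Measure.map_apply hm hs, Measure.map_apply (by fun_prop) (hm hs), Measure.pi_pi] at h
  have e : {y : ι → ℂ | ∀ a, |inner ℝ (b a) (WithLp.toLp 2 y : EuclideanSpace ℂ ι)| < r} =
      WithLp.toLp 2 ⁻¹' ((fun (h : EuclideanSpace ℂ ι) (a : κ) => inner ℝ (b a) h) ⁻¹'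
        Set.univ.pi fun _ : κ => Set.Ioo (-r) r) := by
    ext y
    simp [abs_lt]
  rw [e, h, Finset.prod_const, Finset.card_univ]
  gcongr
  exact gaussianReal_Ioo_le r

/-! ### Effective gains and the distance to the span of the interfering columns -/

section Gain

variable {N M : ℕ} (H : Matrix (Fin N) (Fin M) ℂ) (i : Fin M)

theorem effGain_nonneg : 0 ≤ effGain H i := sq_nonneg _

/-- Since v = Uz, vᴴh = zᴴ(Uᴴh) = |Uᴴh|. If Uᴴh = 0, the convention 0⁻¹ = 0 makes both sides vanish.
-/
theorem effGain_eq : effGain H i = ‖projCoord H i‖ ^ 2 := by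
  have h : inner ℂ (detVector H i) (chanCol H i) = inner ℂ (mrcVector H i) (projCoord H i) := by
    rw [detVector, sum_inner, PiLp.inner_apply]
    refine Finset.sum_congr rfl fun a _ => ?_
    rw [inner_smul_left, projCoord]
    simp [mul_comm]
  rw [effGain, h, mrcVector, inner_smul_left, inner_self_eq_norm_sq_to_K]
  by_cases h0 : ‖projCoord H i‖ = 0
  · simp [h0]
  · simp only [map_inv₀, Complex.conj_ofReal, Complex.ofReal_inv]
    rw [norm_mul, norm_inv, norm_pow]
    simp
    field_simp

theorem norm_starProjection_chanCol :
    ‖(leftNull H i).starProjection (chanCol H i)‖ = ‖projCoord H i‖ := by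
  rw [Submodule.starProjection_apply, Submodule.norm_coe,
    ← (nullBasis H i).repr.norm_map]
  congr 1
  ext a
  rw [OrthonormalBasis.repr_apply_apply, projCoord,
    Submodule.inner_orthogonalProjectionOnto_eq_of_mem_left]

theorem span_interference :
    {h | ∃ m, m ≠ i ∧ h = chanCol H m} = Set.range fun m : {m // m ≠ i} => chanCol H m := by
  ext h
  constructor
  · rintro ⟨m, hm, rfl⟩
    exact ⟨⟨m, hm⟩, rfl⟩
  · rintro ⟨⟨m, hm⟩, rfl⟩
    exact ⟨m, hm, rfl⟩

/-- A gain below `r ^ 2` means that the `i`-th column is within distance `r` of the span of the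
other columns. -/
theorem exists_norm_sub_lt_of_effGain_lt {r : ℝ} (hr : 0 ≤ r) (h : effGain H i < r ^ 2) :
    ∃ c : {m // m ≠ i} → ℂ, ‖chanCol H i - ∑ m, c m • chanCol H m‖ < r := by
  have hmem : chanCol H i - (leftNull H i).starProjection (chanCol H i) ∈
      Submodule.span ℂ (Set.range fun m : {m // m ≠ i} => chanCol H m) := by
    rw [← span_interference, ← Submodule.orthogonal_orthogonal (Submodule.span ℂ _)]
    exact Submodule.sub_starProjection_mem_orthogonal _
  obtain ⟨c, hc⟩ := (Submodule.mem_span_range_iff_exists_fun ℂ).1 hmem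
  refine ⟨c, ?_⟩
  rw [hc, sub_sub_cancel, norm_starProjection_chanCol]
  rw [effGain_eq] at h
  exact lt_of_pow_lt_pow_left₀ 2 hr h

/-- The M - 1 other columns may be dependent, which only enlarges the null space; the lower bound
thus holds for every matrix, with no exceptional null set. -/
theorem le_finrank_leftNull (hMN : M ≤ N) : N - M + 1 ≤ Module.finrank ℂ (leftNull H i) := by
  have h1 := Submodule.finrank_add_finrank_orthogonal
    (Submodule.span ℂ {h | ∃ m, m ≠ i ∧ h = chanCol H m})
  have h2 : Module.finrank ℂ (Submodule.span ℂ {h | ∃ m, m ≠ i ∧ h = chanCol H m}) ≤ M - 1 := by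
    rw [span_interference]
    refine (finrank_range_le_card (R := ℂ) _).trans ?_
    simp [Fintype.card_subtype_compl]
  rw [finrank_euclideanSpace_fin] at h1
  have := i.pos
  change _ + Module.finrank ℂ (leftNull H i) = N at h1
  omega

end Gain

/-! ### Probability that a column is close to the span of the others -/

section NearSpan

variable {N M : ℕ}

/-- There are `2 (N - M + 1)` vectors, orthonormal over the reals, in the left null space. -/
theorem exists_orthonormal_leftNull (hMN : M ≤ N) (H : Matrix (Fin N) (Fin M) ℂ) (i : Fin M) :
    ∃ b : Fin (2 * (N - M + 1)) → EuclideanSpace ℂ (Fin N),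
      Orthonormal ℝ b ∧ ∀ a, b a ∈ leftNull H i := by
  let V := (leftNull H i).restrictScalars ℝ
  have hV : 2 * (N - M + 1) ≤ Module.finrank ℝ V := by
    have : Module.finrank ℝ V = 2 * Module.finrank ℂ (leftNull H i) :=
      finrank_real_of_complex (leftNull H i)
    have := le_finrank_leftNull H i hMN
    omega
  refine ⟨fun a => (stdOrthonormalBasis ℝ V (Fin.castLE hV a) : EuclideanSpace ℂ (Fin N)), ?_,
    fun a => (stdOrthonormalBasis ℝ V (Fin.castLE hV a)).2⟩
  exact ((stdOrthonormalBasis ℝ V).orthonormal.comp _ (Fin.castLE_injective hV)).comp_linearIsometry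
    V.subtypeₗᵢ

theorem EuclideanSpace.real_inner_eq_re_inner {ι : Type*} [Fintype ι] (x y : EuclideanSpace ℂ ι) :
    inner ℝ x y = (inner ℂ x y).re := by
  rw [PiLp.inner_apply, PiLp.inner_apply, Complex.re_sum]
  rfl

/-- The matrices, given by their columns, whose `i`-th column is within distance `r` of the span
of the other ones. -/
def nearSpan (N : ℕ) (i : Fin M) (r : ℝ) : Set (Fin M → Fin N → ℂ) :=
  {X | ∃ c : {m // m ≠ i} → ℂ,
    ‖(WithLp.toLp 2 (X i) - ∑ m, c m • WithLp.toLp 2 (X m) : EuclideanSpace ℂ (Fin N))‖ < r}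

/-- A union of open sets over the coefficients c. Covering the small-gain event by this set makes
measurability of `effGain` unnecessary. -/
theorem isOpen_nearSpan (i : Fin M) (r : ℝ) : IsOpen (nearSpan N i r) := by
  have : nearSpan N i r = ⋃ c : {m // m ≠ i} → ℂ, {X : Fin M → Fin N → ℂ |
    ‖(WithLp.toLp 2 (X i) - ∑ m, c m • WithLp.toLp 2 (X m) : EuclideanSpace ℂ (Fin N))‖ < r} := by
    ext X
    simp [nearSpan]
  rw [this]
  exact isOpen_iUnion fun c => isOpen_lt (by fun_prop) continuous_const

/-- Tonelli: integrate out coordinate i first, then a constant against probability measures. -/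
theorem measure_pi_le_of_fiber_le {ι : Type*} [Fintype ι] [DecidableEq ι] {X : ι → Type*}
    [∀ i, MeasurableSpace (X i)] (μ : ∀ i, Measure (X i)) [∀ i, IsProbabilityMeasure (μ i)]
    {A : Set (∀ i, X i)} (hA : MeasurableSet A) (i : ι) {B : ℝ≥0∞}
    (h : ∀ x, μ i {y | Function.update x i y ∈ A} ≤ B) : Measure.pi μ A ≤ B := by
  have hf : Measurable (A.indicator (1 : (∀ i, X i) → ℝ≥0∞)) := measurable_one.indicator hA
  obtain ⟨x⟩ : Nonempty (∀ i, X i) :=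
    nonempty_of_isProbabilityMeasure (Measure.pi μ)
  rw [← lintegral_indicator_one hA, lintegral_eq_lmarginal_univ x,
    lmarginal_erase' _ hf (Finset.mem_univ i)]
  calc _ ≤ (∫⋯∫⁻_Finset.univ.erase i, (fun _ => B) ∂μ) x := by
        refine lmarginal_mono (fun x => ?_) x
        refine le_trans (le_of_eq ?_) (h x)
        have hm : MeasurableSet {y | Function.update x i y ∈ A} :=
          (measurable_update x) hA
        rw [← lintegral_indicator_one hm]
        rfl
    _ = B := by simp [lmarginal]

/-- The null vectors b depend only on the frozen columns and annihilate them, so pairing b a with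
the random column y is the same as pairing it with y minus any combination of these; Cauchy-Schwarz
bounds the result by r. -/
theorem pi_nearSpan_le (hMN : M ≤ N) (i : Fin M) (r : ℝ) :
    (Measure.pi fun _ : Fin M => Measure.pi fun _ : Fin N => stdComplexGaussian)
      (nearSpan N i r) ≤ ENNReal.ofReal (2 * r) ^ (2 * (N - M + 1)) := by
  refine measure_pi_le_of_fiber_le _ (isOpen_nearSpan i r).measurableSet i fun X => ?_
  obtain ⟨b, hb, hmem⟩ := exists_orthonormal_leftNull hMN (fun a m => X m a) i
  refine (measure_mono ?_).trans ((pi_stdComplexGaussian_inner_lt_le hb r).trans_eq (by simp))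
  rintro y ⟨c, hc⟩ a
  have hne : ∀ m : {m // m ≠ i}, Function.update X i y m = X m := fun m =>
    Function.update_of_ne m.2 _ _
  simp only [Function.update_self, hne] at hc
  have horth : ∀ m : {m // m ≠ i}, inner ℂ (b a) (WithLp.toLp 2 (X m) : EuclideanSpace ℂ (Fin N)) =
      0 := fun m => (Submodule.mem_orthogonal' _ _).1 (hmem a) _
        (Submodule.subset_span ⟨m, m.2, rfl⟩)
  have e : inner ℂ (b a) (WithLp.toLp 2 y : EuclideanSpace ℂ (Fin N)) =
      inner ℂ (b a) (WithLp.toLp 2 y - ∑ m, c m • WithLp.toLp 2 (X m) :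
        EuclideanSpace ℂ (Fin N)) := by
    rw [inner_sub_right, inner_sum]
    simp [inner_smul_right, horth]
  rw [EuclideanSpace.real_inner_eq_re_inner, e]
  calc _ ≤ _ := Complex.abs_re_le_norm _
    _ ≤ _ := norm_inner_le_norm _ _
    _ < r := by rwa [hb.1 a, one_mul]

end NearSpan

/-! ### Joint law of the channels -/

/-- Regroups independent entries by user, then column, then row; checked on boxes. -/
theorem pi_prod_prod_eq_map {α β κ X : Type*} [Fintype α] [Fintype β] [Fintype κ]
    [MeasurableSpace X] (γ : Measure X) [SigmaFinite γ] :
    (Measure.pi fun _ : κ × α × β => γ) =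
      (Measure.pi fun _ : κ => Measure.pi fun _ : β => Measure.pi fun _ : α => γ).map
        fun Y e => Y e.1 e.2.2 e.2.1 := by
  refine Measure.pi_eq fun s hs => ?_
  have hm : Measurable fun (Y : κ → β → α → X) (e : κ × α × β) => Y e.1 e.2.2 e.2.1 := by
    fun_prop
  rw [Measure.map_apply hm (MeasurableSet.univ_pi hs)]
  have e : (fun (Y : κ → β → α → X) (e : κ × α × β) => Y e.1 e.2.2 e.2.1) ⁻¹' Set.univ.pi s =
      Set.univ.pi fun j => Set.univ.pi fun b => Set.univ.pi fun a => s (j, a, b) := by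
    ext Y
    simp only [Set.mem_preimage, Set.mem_univ_pi, Prod.forall]
    exact forall_congr' fun j => forall_comm
  rw [e]
  simp_rw [Measure.pi_pi, Fintype.prod_prod_type]
  exact Finset.prod_congr rfl fun j _ => Finset.prod_comm

section Outage

variable {Ω : Type*} [MeasurableSpace Ω] {μ : Measure Ω} [IsProbabilityMeasure μ] {M N K : ℕ}
  {H : Fin K → Ω → Matrix (Fin N) (Fin M) ℂ}

theorem IsRayleigh.measure_forall_mem (hH : IsRayleigh μ H) {A : Set (Fin M → Fin N → ℂ)}
    (hA : MeasurableSet A) (S : Finset (Fin K)) :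
    μ {ω | ∀ j ∈ S, (fun m a => H j ω a m) ∈ A} =
      (Measure.pi fun _ : Fin M => Measure.pi fun _ : Fin N => stdComplexGaussian) A ^ S.card := by
  have hae : ∀ e : Fin K × Fin N × Fin M, AEMeasurable (fun ω => H e.1 ω e.2.1 e.2.2) μ :=
    fun e => (hH.law _ _ _).aemeasurable
  have hlaw := (iIndepFun_iff_map_fun_eq_pi_map hae).1 hH.indep
  simp_rw [(hH.law _ _ _).map_eq] at hlaw
  rw [pi_prod_prod_eq_map] at hlaw
  have hB : MeasurableSet {Y : Fin K × Fin N × Fin M → ℂ |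
      ∀ j ∈ S, (fun m a => Y (j, a, m)) ∈ A} := by
    have : {Y : Fin K × Fin N × Fin M → ℂ | ∀ j ∈ S, (fun m a => Y (j, a, m)) ∈ A} =
        ⋂ j ∈ S, (fun Y m a => Y (j, a, m)) ⁻¹' A := by
      ext Y
      simp
    rw [this]
    exact S.measurableSet_biInter fun j _ => (by fun_prop : Measurable _) hA
  have h := congrArg (fun m => m {Y | ∀ j ∈ S, (fun m a => Y (j, a, m)) ∈ A}) hlaw
  beta_reduce at h
  rw [Measure.map_apply_of_aemeasurable (aemeasurable_pi_lambda _ hae) hB,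
    Measure.map_apply (by fun_prop) hB] at h
  refine h.trans ?_
  have e : (fun (Y : Fin K → Fin M → Fin N → ℂ) (e : Fin K × Fin N × Fin M) =>
      Y e.1 e.2.2 e.2.1) ⁻¹' {Y | ∀ j ∈ S, (fun m a => Y (j, a, m)) ∈ A} =
      -- A box over the users: those outside S are unconstrained and contribute a factor 1.
      Set.univ.pi fun j => if j ∈ S then A else Set.univ := by
    ext Y
    simp only [Set.mem_preimage, Set.mem_ofPred_eq, Set.mem_univ_pi]
    refine forall_congr' fun j => ?_
    by_cases hj : j ∈ S <;> simp [hj]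
  rw [e, Measure.pi_pi, ← Finset.prod_const, ← Finset.prod_subset (Finset.subset_univ S)]
  · exact Finset.prod_congr rfl fun j hj => by simp [hj]
  · intro j _ hj
    simp [hj]

theorem IsRayleigh.measure_forall_effGain_lt_le (hH : IsRayleigh μ H) (hMN : M ≤ N) (i : Fin M) {ε : ℝ}
    (hε : 0 ≤ ε) (S : Finset (Fin K)) :
    μ {ω | ∀ j ∈ S, effGain (H j ω) i < ε} ≤
      ENNReal.ofReal (4 * ε) ^ ((N - M + 1) * S.card) := by
  have hsq : Real.sqrt ε ^ 2 = ε := Real.sq_sqrt hε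
  calc _ ≤ μ {ω | ∀ j ∈ S, (fun m a => H j ω a m) ∈ nearSpan N i (Real.sqrt ε)} := by
        refine measure_mono fun ω hω j hj => ?_
        exact exists_norm_sub_lt_of_effGain_lt _ _ (Real.sqrt_nonneg ε)
          (by simpa [hsq] using hω j hj)
    _ ≤ (ENNReal.ofReal (2 * Real.sqrt ε) ^ (2 * (N - M + 1))) ^ S.card := by
        rw [hH.measure_forall_mem (isOpen_nearSpan i _).measurableSet]
        gcongr
        exact pi_nearSpan_le hMN i _
    _ = _ := by
        -- (2√ε)² = 4ε.
        rw [pow_mul, ← ENNReal.ofReal_pow (by positivity), mul_pow, hsq, ← pow_mul]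
        norm_num

/-! ### Union bound for the outage probability -/

theorem IsRayleigh.outageProb_le (hH : IsRayleigh μ H) (hMN : M ≤ N) (i : Fin M) (n k : ℕ)
    (hn : 1 ≤ n ∧ n ≤ K) (hk : 1 ≤ k ∧ k ≤ K) (hnk : n ≤ k) (Rn Rk : ℝ) {ρ : ℝ} (hρ : 0 < ρ) :
    outageProb μ H i n k hn hk Rn Rk ρ ≤
      2 ^ K * ENNReal.ofReal (4 * ((2 ^ max Rk Rn) ^ 2 / ρ)) ^ ((N - M + 1) * (K - k + 1)) := by
  set ε : ℝ := (2 ^ max Rk Rn) ^ 2 / ρ with hε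
  have hε0 : 0 ≤ ε := by positivity
  have hsub : {ω | StrongOutage Rk Rn ρ (userGain H i k hk ω) (userGain H i n hn ω)} ⊆
      ⋃ S ∈ Finset.univ.filter (fun S : Finset (Fin K) => S.card = K - k + 1),
        {ω | ∀ j ∈ S, effGain (H j ω) i < ε} := by
    intro ω hω
    have h0 : 0 ≤ userGain H i k hk ω := effGain_nonneg _ _
    have hle : userGain H i k hk ω ≤ userGain H i n hn ω :=
      orderedDesc_antitone _ (Fin.mk_le_mk.2 (by omega))
    obtain ⟨S, hS, hlt⟩ := exists_card_of_orderedDesc_lt (hω.gain_lt hρ h0 hle)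
    simp only [Set.mem_iUnion]
    -- The k-th user has zero-based rank k - 1, and K - (k - 1) = K - k + 1 because 1 ≤ k ≤ K.
    exact ⟨S, by simp only [Finset.mem_filter, Finset.mem_univ, true_and, hS]; omega, hlt⟩
  calc _ ≤ ∑ S ∈ Finset.univ.filter (fun S : Finset (Fin K) => S.card = K - k + 1),
        μ {ω | ∀ j ∈ S, effGain (H j ω) i < ε} :=
        (measure_mono hsub).trans (measure_biUnion_finset_le _ _)
    _ ≤ ∑ S ∈ Finset.univ.filter (fun S : Finset (Fin K) => S.card = K - k + 1),
        ENNReal.ofReal (4 * ε) ^ ((N - M + 1) * (K - k + 1)) := by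
        refine Finset.sum_le_sum fun S hS => ?_
        rw [← (Finset.mem_filter.1 hS).2]
        exact hH.measure_forall_effGain_lt_le hMN i hε0 S
    _ ≤ _ := by
        rw [Finset.sum_const, nsmul_eq_mul]
        gcongr
        -- The crude count 2^K suffices, as it does not depend on ρ.
        have := Finset.card_filter_le (Finset.univ : Finset (Finset (Fin K)))
          fun S => S.card = K - k + 1
        simp only [Finset.card_univ, Fintype.card_finset, Fintype.card_fin] at this
        exact_mod_cast this

theorem IsRayleigh.outageProb_le_const_mul_rpow (hH : IsRayleigh μ H) (hMN : M ≤ N) (i : Fin M)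
    (n k : ℕ)
    (hn : 1 ≤ n ∧ n ≤ K) (hk : 1 ≤ k ∧ k ≤ K) (hnk : n ≤ k) (Rn Rk : ℝ) :
    ∃ C : ℝ, 0 < C ∧ ∀ᶠ ρ in atTop, outageProb μ H i n k hn hk Rn Rk ρ ≤
      ENNReal.ofReal (C * ρ ^ (-(((N - M + 1) * (K - k + 1) : ℕ) : ℝ))) := by
  refine ⟨2 ^ K * (4 * (2 ^ max Rk Rn) ^ 2) ^ ((N - M + 1) * (K - k + 1)), by positivity, ?_⟩
  filter_upwards [eventually_gt_atTop 0] with ρ hρ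
  refine (hH.outageProb_le hMN i n k hn hk hnk Rn Rk hρ).trans_eq ?_
  rw [← ENNReal.ofReal_pow (by positivity), show (2 : ℝ≥0∞) = ENNReal.ofReal 2 by simp,
    ← ENNReal.ofReal_pow (by positivity), ← ENNReal.ofReal_mul (by positivity),
    Real.rpow_neg hρ.le, Real.rpow_natCast, ← mul_div_assoc, div_pow, mul_assoc, div_eq_mul_inv]

end Outage

theorem lemma4 {Ω : Type*} [MeasurableSpace Ω] (μ : Measure Ω) [IsProbabilityMeasure μ]
    (M N K : ℕ) (hMN : M ≤ N) (i : Fin M)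
    (H : Fin K → Ω → Matrix (Fin N) (Fin M) ℂ) (hH : IsRayleigh μ H)
    (n k : ℕ) (hn : 1 ≤ n ∧ n ≤ K) (hk : 1 ≤ k ∧ k ≤ K) (hnk : n < k) (Rn Rk : ℝ) :
    (∀ ρ : ℝ, 0 < ρ → ∀ ω,
        alphaN ρ (userGain H i k hk ω) ∈ Set.Icc (0 : ℝ) 1 ∧
        omaRateWeak ρ (userGain H i k hk ω) ≤ nomaRateWeak ρ (userGain H i k hk ω)) ∧
      ExpLE (outageProb μ H i n k hn hk Rn Rk)
        (fun ρ => ENNReal.ofReal (ρ ^ (-(((N - M + 1) * (K - k + 1) : ℕ) : ℝ)))) ∧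
      AchievesDiversity (outageProb μ H i n k hn hk Rn Rk)
        (((N - M + 1) * (K - k + 1) : ℕ) : ℝ) := by
  obtain ⟨C, hC, h⟩ := hH.outageProb_le_const_mul_rpow hMN i n k hn hk hnk.le Rn Rk
  refine ⟨fun ρ hρ ω => ?_, expLE_rpow hC h, achievesDiversity_of_le hC h⟩
  have h0 : 0 ≤ userGain H i k hk ω := effGain_nonneg _ _
  exact ⟨alphaN_mem_Icc (by positivity), omaRateWeak_le_nomaRateWeak hρ h0⟩
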